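/- Let $\epsilon > 0$. There is a constant $C = C(\epsilon)$, depending only on $\epsilon$, such that the following holds. Let $k$ be a natural number and let $G$ be a finite simple graph with no isolated vertices and with maximum degree $\Delta \ge 2$ that is $S_k$-free, i.e. that does not contain the star $S_k = K_{1,k}$ on $k+1$ vertices as an induced subgraph. Then $$\chi_{ON}(G) \le C \, k \, (\log \Delta)^{2+\epsilon}.$$ Here the conflict-free chromatic number on open neighborhoods $\chi_{ON}(G)$ is the smallest number of colors in an assignment of colors to the vertices of $G$ such that, for every vertex $v$, the open neighborhood $N_G(v) = \{u : uv \in E(G)\}$ contains a vertex whose color is distinct from the color of every other vertex of $N_G(v)$. -/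

import Mathlib

/-- A vertex assignment `c` is a conflict-free coloring of the hypergraph `H`: every hyperedge
contains a vertex whose color differs from that of every other vertex of the hyperedge. -/
def Hypergraph.IsConflictFree {V κ : Type*} (H : Hypergraph V) (c : V → κ) : Prop :=
  ∀ e ∈ H.edgeSet, ∃ x ∈ e, ∀ y ∈ e, y ≠ x → c y ≠ c x

/-- `H` has a conflict-free coloring with the colors `0, …, n - 1`. -/
def Hypergraph.ConflictFreeColorable {V : Type*} (H : Hypergraph V) (n : ℕ) : Prop :=
  ∃ c : V → ℕ, (∀ v ∈ H.vertexSet, c v < n) ∧ H.IsConflictFree c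

/-- The conflict-free chromatic number of a hypergraph: the smallest number of colors in a
conflict-free coloring; it is `⊤` if there is no such coloring with finitely many colors. -/
noncomputable def Hypergraph.conflictFreeChromaticNumber {V : Type*} (H : Hypergraph V) : ℕ∞ :=
  ⨅ n ∈ {n : ℕ | H.ConflictFreeColorable n}, (n : ℕ∞)

/-- The hypergraph on the vertices of `G` whose hyperedges are the open neighborhoods. -/
def SimpleGraph.openNeighborhoodHypergraph {V : Type*} (G : SimpleGraph V) : Hypergraph V where
  vertexSet := Set.univ
  edgeSet := Set.range G.neighborSet
  subset_vertexSet_of_mem_edgeSet' := fun e _ => Set.subset_univ e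

/-- The conflict-free chromatic number on open neighborhoods. -/
noncomputable def SimpleGraph.cfonChromaticNumber {V : Type*} (G : SimpleGraph V) : ℕ∞ :=
  G.openNeighborhoodHypergraph.conflictFreeChromaticNumber

/-- `G` is `S_k`-free: the star `K_{1,k}` on `k + 1` vertices is not an induced subgraph of `G`. -/
def SimpleGraph.StarFree {V : Type*} (G : SimpleGraph V) (k : ℕ) : Prop :=
  ¬ (completeBipartiteGraph (Fin 1) (Fin k)).IsIndContained G

/-! Put `L = Nat.log 2 Δ + 1` and call a degree low if it is below `28 * L`. Vertices with a common
low-degree neighbor are declared to conflict, and a proper coloring of the conflict graph makes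
every low-degree neighborhood rainbow. In a star-free graph the low-degree neighbors of `x` contain
an independent set with at least a `1 / (28 * L)` fraction of them, and it has fewer than `k`
elements; so conflict degrees are at most `k * (28 * L) ^ 2` (`card_lowDegreeConflicts_le`).

A neighborhood of size of order `L` has a uniquely occurring color with high probability when order
`L` colors are used, and the local lemma achieves this together with properness
(`exists_proper_coloring_unique_color`). Larger neighborhoods are shrunk: `exists_balanced_split`
cuts the current vertex set in two so that each part keeps a constant fraction of every large set.
One part gets a fresh palette serving the medium neighborhoods, and the other is treated recursively
for the larger ones (`exists_coloring_of_large`). After `6 * L` rounds nothing large remains.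
Conflict degrees shrink geometrically too, so the palettes add up to order `k * L ^ 2` colors. The
exponent `ε` is not needed for the argument and only enlarges the bound. -/

/-! ### The local lemma by counting -/

open Finset in
/-- Events depending on disjoint sets of coordinates are independent under the uniform
distribution on `V → κ`. -/
theorem card_filter_and_mul_card {V κ : Type*} [Fintype V] [DecidableEq V] [Fintype κ]
    (s : Finset V) (P Q : (V → κ) → Prop) [DecidablePred P] [DecidablePred Q]
    (hP : ∀ f g, (∀ x ∈ s, f x = g x) → P f → P g)
    (hQ : ∀ f g, (∀ x ∉ s, f x = g x) → Q f → Q g) :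
    #{f | P f ∧ Q f} * Fintype.card (V → κ) = #{f | P f} * #{f | Q f} := by
  rw [← Finset.card_univ, ← Finset.card_product, ← Finset.card_product]
  -- Exchanging the values on `s` between the two members of a pair is an involution.
  refine Finset.card_bij'
    (fun p _ => (s.piecewise p.1 p.2, s.piecewise p.2 p.1))
    (fun p _ => (s.piecewise p.1 p.2, s.piecewise p.2 p.1)) ?_ ?_ ?_ ?_
  · rintro ⟨f, g⟩ h
    simp only [mem_product, mem_filter, mem_univ, true_and, and_true] at h ⊢
    exact ⟨hP f _ (fun x hx => by simp [hx]) h.1, hQ f _ (fun x hx => by simp [hx]) h.2⟩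
  · rintro ⟨f, g⟩ h
    simp only [mem_product, mem_filter, mem_univ, true_and, and_true] at h ⊢
    exact ⟨hP f _ (fun x hx => by simp [hx]) h.1, hQ g _ (fun x hx => by simp [hx]) h.2⟩
  · rintro ⟨f, g⟩ -
    ext x <;> by_cases hx : x ∈ s <;> simp [hx]
  · rintro ⟨f, g⟩ -
    ext x <;> by_cases hx : x ∈ s <;> simp [hx]

open Finset Classical in
/-- The number of colorings that avoid all bad events with scope inside `S`. -/
noncomputable def avoidCount {V κ ι : Type*} [Fintype V] [DecidableEq V] [Fintype κ]
    [Fintype ι]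
    (e : ι → Finset V) (bad : ι → (V → κ) → Prop) (S : Finset V) : ℕ :=
  #{f : V → κ | ∀ i, e i ⊆ S → ¬ bad i f}

/-- The one-vertex inequality is iterated along a chain from `R` to `S`. It is assumed only for
proper subsets of `S`, so that it can serve as the induction hypothesis in the proof of the
one-vertex inequality itself. -/
theorem pow_mul_avoidCount_le {V κ ι : Type*} [Fintype V] [DecidableEq V] [Fintype κ]
    [Fintype ι]
    (e : ι → Finset V) (bad : ι → (V → κ) → Prop) {γ : ℝ} (hγ : 0 < γ) (S : Finset V)
    (h : ∀ R, R ⊂ S → ∀ v ∈ S, v ∉ R →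
      γ * avoidCount e bad R ≤ avoidCount e bad (insert v R)) :
    ∀ (n : ℕ) (R : Finset V), R ⊆ S → S.card = R.card + n →
      γ ^ n * avoidCount e bad R ≤ avoidCount e bad S := by
  intro n
  induction n with
  | zero =>
    intro R hR hc
    rw [Finset.eq_of_subset_of_card_le hR (by omega)]
    simp
  | succ n ih =>
    intro R hR hc
    have hss : R ⊂ S := hR.ssubset_of_ne (by rintro rfl; omega)
    obtain ⟨v, hvS, hvR⟩ := Finset.exists_of_ssubset hss
    have h1 := ih (insert v R) (Finset.insert_subset hvS hR)
      (by rw [Finset.card_insert_of_notMem hvR]; omega)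
    have h2 := h R hss v hvS hvR
    calc γ ^ (n + 1) * avoidCount e bad R = γ ^ n * (γ * avoidCount e bad R) := by ring
      _ ≤ γ ^ n * avoidCount e bad (insert v R) := by gcongr
      _ ≤ _ := h1

open Finset Classical in
/-- Adding one vertex to the set of constrained vertices costs at most a factor `γ`. -/
theorem mul_avoidCount_le_avoidCount_insert {V κ ι : Type*} [Fintype V] [DecidableEq V]
    [Fintype κ] [Nonempty κ] [Fintype ι]
    (e : ι → Finset V) (bad : ι → (V → κ) → Prop)
    (hdep : ∀ i f g, (∀ x ∈ e i, f x = g x) → bad i f → bad i g)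
    {γ : ℝ} (hγ : 0 < γ) (p : ι → ℝ)
    (hp : ∀ i, (#{f | bad i f} : ℝ) ≤ p i * Fintype.card (V → κ))
    (hsum : ∀ v, ∑ i with v ∈ e i, p i * γ⁻¹ ^ (#(e i) - 1) ≤ 1 - γ) :
    ∀ (S : Finset V) (v : V), v ∉ S →
      γ * avoidCount e bad S ≤ avoidCount e bad (insert v S) := by
  intro S
  induction S using Finset.strongInduction with
  | H S ih =>
  intro v hv
  have hq : (0 : ℝ) < Fintype.card (V → κ) := by exact_mod_cast Fintype.card_pos
  have hp0 : ∀ i, 0 ≤ p i := fun i => by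
    have : 0 ≤ p i * Fintype.card (V → κ) := le_trans (Nat.cast_nonneg _) (hp i)
    exact nonneg_of_mul_nonneg_left this hq
  have hchain := pow_mul_avoidCount_le e bad hγ S (fun R hR w _ hw => ih R hR w hw)
  have hevent : ∀ i, v ∈ e i → e i ⊆ insert v S →
      (#{f | bad i f ∧ ∀ j, e j ⊆ S \ e i → ¬ bad j f} : ℝ) ≤
        p i * γ⁻¹ ^ (#(e i) - 1) * avoidCount e bad S := by
    intro i hvi hi
    -- The constraints are weakened to scopes disjoint from `e i`, which makes them independent of
    -- `bad i`.
    have hind := card_filter_and_mul_card (e i) (fun f => bad i f)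
      (fun f => ∀ j, e j ⊆ S \ e i → ¬ bad j f) (hdep i)
      (fun f g hfg hf j hj hb => hf j hj (hdep j g f (fun x hx =>
        (hfg x (Finset.mem_sdiff.1 (hj hx)).2).symm) hb))
    -- Since `v ∉ S`, removing `e i` costs only `#(e i) - 1` vertices; this is the exponent of
    -- `γ⁻¹`.
    have hcard : #S = #(S \ e i) + (#(e i) - 1) := by
      have h1 : S \ e i = S \ (e i).erase v := by
        ext x
        simp only [mem_sdiff, mem_erase]
        refine and_congr_right fun hx => ?_
        have : x ≠ v := by rintro rfl; exact hv hx
        tauto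
      have h2 : (e i).erase v ⊆ S := by
        intro x hx
        rw [mem_erase] at hx
        exact (mem_insert.1 (hi hx.2)).resolve_left hx.1
      rw [h1, ← Finset.card_erase_of_mem hvi, Finset.card_sdiff_add_card_eq_card h2]
    have h3 := hchain _ (S \ e i) sdiff_subset hcard
    have h4 : (avoidCount e bad (S \ e i) : ℝ) ≤
        γ⁻¹ ^ (#(e i) - 1) * avoidCount e bad S := by
      rw [inv_pow, ← div_eq_inv_mul, le_div_iff₀' (by positivity)]
      exact h3
    have h5 : (#{f | bad i f ∧ ∀ j, e j ⊆ S \ e i → ¬ bad j f} : ℝ) *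
        Fintype.card (V → κ) = #{f | bad i f} * (avoidCount e bad (S \ e i) : ℝ) := by
      unfold avoidCount
      exact_mod_cast hind
    refine le_of_mul_le_mul_right ?_ hq
    rw [h5]
    calc (#{f | bad i f} : ℝ) * (avoidCount e bad (S \ e i) : ℝ)
        ≤ (p i * Fintype.card (V → κ)) * (γ⁻¹ ^ (#(e i) - 1) * avoidCount e bad S) := by
          have := hp0 i
          gcongr
          exact hp i
      _ = _ := by ring
  -- A coloring lost when `v` is added violates an event whose scope contains `v`; a union bound
  -- over these events follows.
  have hsub : (univ.filter fun f : V → κ => ∀ i, e i ⊆ S → ¬ bad i f) ⊆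
      (univ.filter fun f : V → κ => ∀ i, e i ⊆ insert v S → ¬ bad i f) ∪
      (univ.filter fun i => v ∈ e i ∧ e i ⊆ insert v S).biUnion (fun i =>
        univ.filter fun f : V → κ => bad i f ∧ ∀ j, e j ⊆ S \ e i → ¬ bad j f) := by
    intro f hf
    simp only [mem_filter, mem_univ, true_and, mem_union, mem_biUnion] at hf ⊢
    by_contra! hcon
    obtain ⟨⟨i, hi, hb⟩, h2⟩ := hcon
    have hvi : v ∈ e i := by
      by_contra hvi
      exact hf i (fun x hx => (mem_insert.1 (hi hx)).resolve_left
        (by rintro rfl; exact hvi hx)) hb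
    obtain ⟨j, hj, hbj⟩ := h2 i ⟨hvi, hi⟩ hb
    exact hf j (hj.trans sdiff_subset) hbj
  have hle := (card_le_card hsub).trans (card_union_le _ _)
  have hle2 : (avoidCount e bad S : ℝ) ≤ avoidCount e bad (insert v S) +
      ∑ i with v ∈ e i ∧ e i ⊆ insert v S,
        (#{f | bad i f ∧ ∀ j, e j ⊆ S \ e i → ¬ bad j f} : ℝ) := by
    have := hle.trans (Nat.add_le_add_left card_biUnion_le _)
    unfold avoidCount
    exact_mod_cast this
  have hle3 : ∑ i with v ∈ e i ∧ e i ⊆ insert v S,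
        (#{f | bad i f ∧ ∀ j, e j ⊆ S \ e i → ¬ bad j f} : ℝ) ≤
      (1 - γ) * avoidCount e bad S := by
    calc _ ≤ ∑ i with v ∈ e i ∧ e i ⊆ insert v S,
          p i * γ⁻¹ ^ (#(e i) - 1) * avoidCount e bad S := by
          refine sum_le_sum fun i hi => ?_
          rw [mem_filter] at hi
          exact hevent i hi.2.1 hi.2.2
      _ ≤ ∑ i with v ∈ e i, p i * γ⁻¹ ^ (#(e i) - 1) * avoidCount e bad S := by
          refine sum_le_sum_of_subset_of_nonneg ?_ fun i _ _ => ?_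
          · intro i hi
            rw [mem_filter] at hi ⊢
            exact ⟨hi.1, hi.2.1⟩
          · have := hp0 i
            positivity
      _ = (∑ i with v ∈ e i, p i * γ⁻¹ ^ (#(e i) - 1)) * avoidCount e bad S := by
          rw [sum_mul]
      _ ≤ _ := by
          gcongr
          exact hsum v
  linarith

open Finset in
/-- A form of the Lovász local lemma for uniformly random colorings: if the event `bad i` depends
only on the colors of `e i`, has probability at most `p i`, and
`∑_{i : v ∈ e i} p i * γ⁻¹ ^ (|e i| - 1) ≤ 1 - γ` for every vertex `v`, then some coloring
avoids all bad events. -/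
theorem exists_avoiding {V κ ι : Type*} [Fintype V] [DecidableEq V]
    [Fintype κ] [Nonempty κ] [Fintype ι]
    (e : ι → Finset V) (bad : ι → (V → κ) → Prop) (hne : ∀ i, (e i).Nonempty)
    (hdep : ∀ i f g, (∀ x ∈ e i, f x = g x) → bad i f → bad i g)
    {γ : ℝ} (hγ : 0 < γ) (p : ι → ℝ)
    (hp : ∀ i, ∃ s : Finset (V → κ), (∀ f, bad i f → f ∈ s) ∧
      (#s : ℝ) ≤ p i * Fintype.card (V → κ))
    (hsum : ∀ v, ∑ i with v ∈ e i, p i * γ⁻¹ ^ (#(e i) - 1) ≤ 1 - γ) :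
    ∃ f : V → κ, ∀ i, ¬ bad i f := by
  classical
  have hstep := mul_avoidCount_le_avoidCount_insert e bad hdep hγ p (fun i => by
    obtain ⟨s, hs, hcard⟩ := hp i
    exact (Nat.cast_le.2 (card_le_card fun f hf => hs f (mem_filter.1 hf).2)).trans hcard) hsum
  have h := pow_mul_avoidCount_le e bad hγ univ (fun R _ v _ hv => hstep R v hv)
    (Fintype.card V) ∅ (empty_subset _) (by simp)
  have h0 : avoidCount e bad ∅ = Fintype.card (V → κ) := by
    unfold avoidCount
    rw [filter_true_of_mem, card_univ]
    intro f _ i hi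
    exact absurd (subset_empty.1 hi) (hne i).ne_empty
  have hq : (0 : ℝ) < Fintype.card (V → κ) := by exact_mod_cast Fintype.card_pos
  have hpos : 0 < avoidCount e bad univ := by
    have : (0 : ℝ) < avoidCount e bad univ := lt_of_lt_of_le (by rw [h0]; positivity) h
    exact_mod_cast this
  obtain ⟨f, hf⟩ := card_pos.1 hpos
  exact ⟨f, fun i => (mem_filter.1 hf).2 i (subset_univ _)⟩

/-! ### Balanced splits -/

open Finset in
/-- A Chernoff-type bound: few subsets of `V` meet `E` in at most an eighth of its elements. -/
theorem card_filter_eight_mul_le {V : Type*} [Fintype V] [DecidableEq V] (E : Finset V)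
    (b : Bool) :
    (#{f : V → Bool | 8 * #{x ∈ E | f x = b} ≤ #E} : ℝ) ≤
      (73 / 100 : ℝ) ^ #E * Fintype.card (V → Bool) := by
  -- Exponential moment with weight `r ^ (-7)` for the color `b` and `r` for the other: the product
  -- over `E` is at least `1` when at most an eighth of `E` has color `b`, and the mean weight `(r ^
  -- (-7) + r) / 2` is below `73 / 100`.
  set r : ℝ := 13 / 10 with hr
  set w : V → Bool → ℝ := fun x c => if x ∈ E then (if c = b then (r ^ 7)⁻¹ else r) else 1
    with hw
  have hr0 : 0 < r := by norm_num [hr]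
  have hw0 : ∀ x c, 0 ≤ w x c := by
    intro x c
    simp only [hw]
    split_ifs <;> positivity
  have hone : ∀ f : V → Bool, 8 * #{x ∈ E | f x = b} ≤ #E → 1 ≤ ∏ x, w x (f x) := by
    intro f hf
    have h1 : ∏ x, w x (f x) = ∏ x ∈ E, if f x = b then (r ^ 7)⁻¹ else r := by
      simp only [hw]
      rw [← Finset.prod_filter]
      simp
    have h2 := Finset.card_filter_add_card_filter_not (s := E) (fun x => f x = b)
    rw [h1, Finset.prod_ite, prod_const, prod_const, inv_pow, ← pow_mul,
      ← div_eq_inv_mul, one_le_div (by positivity)]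
    exact pow_le_pow_right₀ (by norm_num [hr]) (by omega)
  have hsum : ∀ x, ∑ c, w x c = (if x ∈ E then (r ^ 7)⁻¹ + r else 2) := by
    intro x
    simp only [hw, Fintype.sum_bool]
    cases b <;> split_ifs <;> simp_all <;> ring
  calc (#{f : V → Bool | 8 * #{x ∈ E | f x = b} ≤ #E} : ℝ)
      = ∑ f : V → Bool with 8 * #{x ∈ E | f x = b} ≤ #E, (1 : ℝ) := by simp
    _ ≤ ∑ f : V → Bool with 8 * #{x ∈ E | f x = b} ≤ #E, ∏ x, w x (f x) :=
        sum_le_sum fun f hf => hone f (mem_filter.1 hf).2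
    _ ≤ ∑ f : V → Bool, ∏ x, w x (f x) :=
        sum_le_sum_of_subset_of_nonneg (filter_subset _ _)
          fun f _ _ => prod_nonneg fun x _ => hw0 x _
    _ = ∏ x, ∑ c, w x c := (Fintype.prod_sum w).symm
    _ = ∏ x, (if x ∈ E then (r ^ 7)⁻¹ + r else 2) := by simp_rw [hsum]
    _ ≤ ∏ x, ((if x ∈ E then 73 / 100 else 1) * 2) := by
        refine prod_le_prod (fun x _ => ?_) fun x _ => ?_
        · split_ifs <;> positivity
        · split_ifs
          · norm_num [hr]
          · norm_num
    _ = _ := by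
        rw [prod_mul_distrib, ← prod_filter]
        simp [div_pow]

open Finset in
/-- If all sets of a family are large compared to the number of sets through a vertex, then the
vertices can be split in two parts each having more than an eighth of every set. -/
theorem exists_balanced_split {V ι : Type*} [Fintype V] [DecidableEq V] [Fintype ι]
    (E : ι → Finset V) {L : ℕ} (hL : 1 ≤ L) (hE : ∀ v, #{i | v ∈ E i} ≤ 4 ^ L)
    (hsize : ∀ i, 28 * L ≤ #(E i)) :
    ∃ A : Finset V, ∀ i, #(E i) < 8 * #(E i ∩ A) ∧ #(E i) < 8 * #(E i \ A) := by
  classical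
  obtain ⟨f, hf⟩ := exists_avoiding (κ := Bool) E
    (fun i f => ∃ b : Bool, 8 * #{x ∈ E i | f x = b} ≤ #(E i))
    (fun i => by
      rw [← card_pos]
      have := hsize i
      omega)
    (fun i f g hfg ⟨b, hb⟩ => ⟨b, by
      rwa [filter_congr (q := fun x => g x = b) fun x hx => by rw [hfg x hx]] at hb⟩)
    (γ := 9 / 10) (by norm_num) (fun i => 2 * (73 / 100 : ℝ) ^ #(E i))
    (fun i => by
      have h1 := card_filter_eight_mul_le (E i) true
      have h2 := card_filter_eight_mul_le (E i) false
      refine ⟨(univ.filter fun f : V → Bool => 8 * #{x ∈ E i | f x = true} ≤ #(E i)) ∪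
          (univ.filter fun f : V → Bool => 8 * #{x ∈ E i | f x = false} ≤ #(E i)), ?_, ?_⟩
      · rintro f ⟨b, hb⟩
        simp only [mem_filter, mem_univ, true_and, mem_union]
        cases b
        · exact Or.inr hb
        · exact Or.inl hb
      · refine (Nat.cast_le.2 (card_union_le _ _)).trans ?_
        push_cast
        exact (add_le_add h1 h2).trans_eq (by ring))
    (fun v => by
      have hterm : ∀ i, 2 * (73 / 100 : ℝ) ^ #(E i) * (9 / 10 : ℝ)⁻¹ ^ (#(E i) - 1) ≤
          (1 / 4) ^ L * (1 / 10) := by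
        intro i
        have hs : 28 * L ≤ #(E i) := hsize i
        obtain ⟨s, hs'⟩ : ∃ s, #(E i) = s + 1 := ⟨#(E i) - 1, by omega⟩
        rw [hs', Nat.add_sub_cancel, pow_succ, mul_assoc, mul_assoc, mul_left_comm _ (73 / 100 : ℝ),
          ← mul_pow]
        -- As `L ≥ 1`, `28 * L ≥ 8 * L + 20`. Eight factors `(73 / 100) / (9 / 10)` are below `1 /
        -- 4`, which beats the `4 ^ L` sets through `v`; the remaining factors leave `1 / 10 = 1 -
        -- γ`.
        calc 2 * (73 / 100 * (73 / 100 * (9 / 10 : ℝ)⁻¹) ^ s)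
            ≤ 2 * (73 / 100 * (73 / 100 * (9 / 10 : ℝ)⁻¹) ^ (8 * L + 19)) := by
              gcongr 2 * (73 / 100 * ?_)
              exact pow_le_pow_of_le_one (by norm_num) (by norm_num) (by omega)
          _ = ((73 / 100 * (9 / 10 : ℝ)⁻¹) ^ 8) ^ L *
              (2 * (73 / 100 * (73 / 100 * (9 / 10 : ℝ)⁻¹) ^ 19)) := by
              rw [pow_add, pow_mul]; ring
          _ ≤ (1 / 4) ^ L * (1 / 10) := by
              gcongr <;> norm_num
      calc _ ≤ ∑ i with v ∈ E i, (1 / 4 : ℝ) ^ L * (1 / 10) := sum_le_sum fun i _ => hterm i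
        _ = #{i | v ∈ E i} * ((1 / 4 : ℝ) ^ L * (1 / 10)) := by simp
        _ ≤ (4 ^ L : ℕ) * ((1 / 4 : ℝ) ^ L * (1 / 10)) := by
            gcongr
            exact hE v
        _ = 1 - 9 / 10 := by
            push_cast
            rw [← mul_assoc, ← mul_pow]
            norm_num)
  refine ⟨univ.filter fun x => f x = true, fun i => ?_⟩
  have h := hf i
  push Not at h
  have h1 : E i ∩ univ.filter (fun x => f x = true) = {x ∈ E i | f x = true} := by
    ext x; simp
  have h2 : E i \ univ.filter (fun x => f x = true) = {x ∈ E i | f x = false} := by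
    ext x; simp
  rw [h1, h2]
  exact ⟨h true, h false⟩

/-! ### Colorings with a uniquely occurring color -/

open Finset in
/-- Few colorings use at most `h` colors on `E`. -/
theorem card_filter_card_image_le {V κ : Type*} [Fintype V] [DecidableEq V] [Fintype κ]
    [DecidableEq κ] (E : Finset V) {h : ℕ} (hq : h ≤ Fintype.card κ) :
    #{f : V → κ | #(E.image f) ≤ h} * Fintype.card κ ^ #E ≤
      (Fintype.card κ).choose h * h ^ #E * Fintype.card (V → κ) := by
  -- Union bound over the `h`-element palettes that contain all colors used on `E`.
  have hsub : (univ.filter fun f : V → κ => #(E.image f) ≤ h) ⊆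
      (univ.powersetCard h).biUnion fun C =>
        Fintype.piFinset fun x => if x ∈ E then C else univ := by
    intro f hf
    obtain ⟨C, hC, hcard⟩ := exists_superset_card_eq (mem_filter.1 hf).2 hq
    refine mem_biUnion.2 ⟨C, mem_powersetCard.2 ⟨subset_univ _, hcard⟩, ?_⟩
    refine Fintype.mem_piFinset.2 fun x => ?_
    split_ifs with hx
    · exact hC (mem_image_of_mem f hx)
    · exact mem_univ _
  have hpi : ∀ C ∈ (univ : Finset κ).powersetCard h,
      #(Fintype.piFinset fun x => if x ∈ E then C else univ) =
        h ^ #E * Fintype.card κ ^ (Fintype.card V - #E) := by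
    intro C hC
    rw [Fintype.card_piFinset]
    have : ∀ x, #(if x ∈ E then C else univ) = if x ∈ E then h else Fintype.card κ := by
      intro x
      split_ifs
      · exact (mem_powersetCard.1 hC).2
      · exact card_univ
    simp_rw [this]
    rw [prod_ite, prod_const, prod_const]
    congr 2
    · simp
    · rw [← card_compl]
      congr 1
      ext x
      simp
  have h1 := (card_le_card hsub).trans card_biUnion_le
  rw [sum_congr rfl hpi, sum_const, card_powersetCard, card_univ, smul_eq_mul] at h1
  calc _ ≤ (Fintype.card κ).choose h * (h ^ #E * Fintype.card κ ^ (Fintype.card V - #E)) *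
        Fintype.card κ ^ #E := Nat.mul_le_mul_right _ h1
    _ = (Fintype.card κ).choose h * h ^ #E *
        (Fintype.card κ ^ (Fintype.card V - #E) * Fintype.card κ ^ #E) := by ring
    _ = _ := by
      rw [← pow_add, Nat.sub_add_cancel (card_le_univ E), Fintype.card_fun]

/-- From `h ^ h / h! ≤ e ^ h` the binomial coefficient is at most `(3 * q / h) ^ h`. Of the `s ≥ 2 *
h` factors `h / q`, `h` cancel `(q / h) ^ h` and `h` more contribute `1 / 192` each, leaving `3 /
192 = 1 / 64`. -/
theorem choose_mul_pow_le {q h s : ℕ} (hh : 0 < h) (hq : 192 * h ≤ q) (hs : 2 * h ≤ s) :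
    (q.choose h : ℝ) * h ^ s ≤ (1 / 64) ^ h * (q : ℝ) ^ s := by
  have hh' : (0 : ℝ) < h := by exact_mod_cast hh
  have hq' : (192 : ℝ) * h ≤ q := by exact_mod_cast hq
  have hq0 : (0 : ℝ) < q := by linarith
  have h1 : (q.choose h : ℝ) ≤ q ^ h / h.factorial := Nat.choose_le_pow_div h q
  have h2 := Real.pow_div_factorial_le_exp h hh'.le h
  have hfac : (0 : ℝ) < h.factorial := by exact_mod_cast h.factorial_pos
  have h3 : Real.exp h ≤ 3 ^ h := by
    rw [← Real.exp_one_pow]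
    gcongr
    exact Real.exp_one_lt_d9.le.trans (by norm_num)
  have h4 : (h : ℝ) ^ h ≤ 3 ^ h * h.factorial := by
    rw [div_le_iff₀ hfac] at h2
    exact h2.trans (by gcongr)
  obtain ⟨m, rfl⟩ : ∃ m, s = 2 * h + m := ⟨s - 2 * h, by omega⟩
  calc (q.choose h : ℝ) * h ^ (2 * h + m)
      ≤ (q ^ h / h.factorial) * h ^ (2 * h + m) := by gcongr
    _ = q ^ h * (h ^ h / h.factorial) * (h ^ h * h ^ m) := by
        rw [pow_add, two_mul, pow_add]; field_simp
    _ ≤ q ^ h * 3 ^ h * (((1 / 192) * q) ^ h * q ^ m) := by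
        gcongr
        · exact (div_le_iff₀ hfac).2 h4
        · linarith
        · linarith
    _ = _ := by
        rw [pow_add, two_mul, pow_add, mul_pow, show (1 / 64 : ℝ) = 3 * (1 / 192) by norm_num,
          mul_pow]
        ring

-- Every color class in `E` has at least two elements.
open Finset in
theorem two_mul_card_image_le_of_forall {V κ : Type*} [DecidableEq V] [DecidableEq κ]
    (E : Finset V) (f : V → κ) (hf : ∀ x ∈ E, ∃ y ∈ E, y ≠ x ∧ f y = f x) :
    2 * #(E.image f) ≤ #E := by
  rw [mul_comm, mul_comm]
  refine mul_card_image_le_card E 2 fun a ha => ?_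
  obtain ⟨x, hx, rfl⟩ := mem_image.1 ha
  obtain ⟨y, hy, hyx, hfy⟩ := hf x hx
  exact one_lt_card.2 ⟨x, by simp [hx], y, by simp [hy, hfy], hyx.symm⟩

open Finset in
/-- A random coloring rarely leaves `E` without a color that occurs exactly once. -/
theorem card_filter_no_unique_color_le {V : Type*} [Fintype V] [DecidableEq V] (E : Finset V)
    {q : ℕ} (hE : 2 ≤ #E) (hq : 96 * #E ≤ q)
    [DecidablePred fun f : V → Fin q => ∀ x ∈ E, ∃ y ∈ E, y ≠ x ∧ f y = f x] :
    (#{f : V → Fin q | ∀ x ∈ E, ∃ y ∈ E, y ≠ x ∧ f y = f x} : ℝ) ≤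
      (1 / 64) ^ (#E / 2) * Fintype.card (V → Fin q) := by
  have hle : #{f : V → Fin q | ∀ x ∈ E, ∃ y ∈ E, y ≠ x ∧ f y = f x} ≤
      #{f : V → Fin q | #(E.image f) ≤ #E / 2} := by
    refine card_le_card fun f hf => ?_
    have := two_mul_card_image_le_of_forall E f (mem_filter.1 hf).2
    exact mem_filter.2 ⟨mem_univ _, by omega⟩
  have h1 := card_filter_card_image_le (κ := Fin q) E (h := #E / 2) (by
    rw [Fintype.card_fin]; omega)
  have h2 := choose_mul_pow_le (q := q) (h := #E / 2) (s := #E) (by omega) (by omega) (by omega)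
  rw [Fintype.card_fin] at h1
  have h1' : (#{f : V → Fin q | #(E.image f) ≤ #E / 2} : ℝ) * (q : ℝ) ^ #E ≤
      (q.choose (#E / 2) : ℝ) * ((#E / 2 : ℕ) : ℝ) ^ #E * Fintype.card (V → Fin q) := by
    exact_mod_cast h1
  have hq0 : (0 : ℝ) < q := by
    have : 0 < q := by omega
    exact_mod_cast this
  have hqs : (0 : ℝ) < (q : ℝ) ^ #E := by positivity
  refine le_trans (Nat.cast_le.2 hle) (le_of_mul_le_mul_right ?_ hqs)
  calc _ ≤ _ := h1'
    _ ≤ ((1 / 64) ^ (#E / 2) * (q : ℝ) ^ #E) * Fintype.card (V → Fin q) := by gcongr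
    _ = _ := by ring

-- Recoloring `x` arbitrarily loses no information, because the old color of `x` can be read off at
-- `y`.
open Finset in
theorem card_filter_apply_eq_mul {V : Type*} [Fintype V] [DecidableEq V] {q : ℕ} {x y : V}
    (hxy : x ≠ y) :
    #{f : V → Fin q | f x = f y} * q ≤ Fintype.card (V → Fin q) := by
  have : #((univ.filter fun f : V → Fin q => f x = f y) ×ˢ (univ : Finset (Fin q))) ≤
      #(univ : Finset (V → Fin q)) := by
    refine card_le_card_of_injOn (fun p => Function.update p.1 x p.2) (fun _ _ => mem_univ _) ?_
    rintro ⟨f, a⟩ hf ⟨g, b⟩ hg h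
    simp only [coe_product, Set.mem_prod, mem_coe, mem_filter, mem_univ, true_and, and_true]
      at hf hg
    simp only at h
    have hab : a = b := by simpa using congrFun h x
    have hz : ∀ z, z ≠ x → f z = g z := fun z hz => by simpa [hz] using congrFun h z
    refine Prod.ext (funext fun z => ?_) hab
    by_cases hzx : z = x
    · subst hzx
      exact hf.trans ((hz y hxy.symm).trans hg.symm)
    · exact hz z hzx
  rwa [card_product, card_univ, card_univ, Fintype.card_fin] at this

open Finset in
/-- A graph of maximum degree at most `d`, given by its neighborhoods `H`, and medium-sized
hyperedges can be colored simultaneously such that the coloring of the graph is proper and every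
hyperedge has a color that occurs exactly once. -/
theorem exists_proper_coloring_unique_color {V ι : Type*} [Fintype V] [DecidableEq V] [Fintype ι]
    (E : ι → Finset V) (H : V → Finset V) {L d q : ℕ} (hL : 1 ≤ L)
    (hirr : ∀ x, x ∉ H x) (hsymm : ∀ x y, y ∈ H x → x ∈ H y) (hd : ∀ x, #(H x) ≤ d)
    (hE : ∀ v, #{i | v ∈ E i} ≤ 2 ^ L) (hlow : ∀ i, 28 * L < 8 * #(E i))
    (hupp : ∀ i, 96 * #(E i) ≤ q) (hq : 16 * d ≤ q) (hq0 : 0 < q) :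
    ∃ f : V → Fin q, (∀ x, ∀ y ∈ H x, f x ≠ f y) ∧
      ∀ i, ∃ x ∈ E i, ∀ y ∈ E i, y ≠ x → f y ≠ f x := by
  classical
  have : NeZero q := ⟨hq0.ne'⟩
  have hq0' : (0 : ℝ) < q := by exact_mod_cast hq0
  let P := {p : V × V // p.2 ∈ H p.1}
  obtain ⟨f, hf⟩ := exists_avoiding (κ := Fin q) (ι := ι ⊕ P)
    (Sum.elim E fun p => {p.1.1, p.1.2})
    (Sum.elim (fun i f => ∀ x ∈ E i, ∃ y ∈ E i, y ≠ x ∧ f y = f x)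
      fun p f => f p.1.1 = f p.1.2)
    (by
      rintro (i | p)
      · rw [Sum.elim_inl, ← card_pos]
        have := hlow i
        omega
      · exact insert_nonempty _ _)
    (by
      rintro (i | p) f g hfg hb
      · simp only [Sum.elim_inl] at hfg hb ⊢
        intro x hx
        obtain ⟨y, hy, hyx, h⟩ := hb x hx
        exact ⟨y, hy, hyx, by rw [← hfg x hx, ← hfg y hy, h]⟩
      · simp only [Sum.elim_inr] at hfg hb ⊢
        rw [← hfg _ (mem_insert_self _ _), hb, hfg _ (by simp)])
    (γ := 1 / 2) (by norm_num)
    (Sum.elim (fun i => (1 / 64 : ℝ) ^ (#(E i) / 2)) fun _ => (q : ℝ)⁻¹)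
    (by
      rintro (i | p)
      · simp only [Sum.elim_inl]
        have := hlow i
        exact ⟨_, fun f hf => mem_filter.2 ⟨mem_univ f, hf⟩,
          card_filter_no_unique_color_le (E i) (q := q) (by omega) (hupp i)⟩
      · simp only [Sum.elim_inr]
        have hne : p.1.1 ≠ p.1.2 := fun h => hirr p.1.1 (by
          have := p.2
          rwa [← h] at this)
        have := card_filter_apply_eq_mul (q := q) hne
        refine ⟨_, fun f hf => mem_filter.2 ⟨mem_univ f, hf⟩, ?_⟩
        rw [← div_eq_inv_mul, le_div_iff₀ hq0']
        exact_mod_cast this)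
    (by
      intro v
      rw [sum_filter, Fintype.sum_sum_type, ← sum_filter, ← sum_filter]
      simp only [Sum.elim_inl, Sum.elim_inr]
      have h1 : ∑ i with v ∈ E i, (1 / 64 : ℝ) ^ (#(E i) / 2) * (1 / 2 : ℝ)⁻¹ ^ (#(E i) - 1) ≤
          1 / 4 := by
        have hterm : ∀ i, (1 / 64 : ℝ) ^ (#(E i) / 2) * (1 / 2 : ℝ)⁻¹ ^ (#(E i) - 1) ≤
            (1 / 2) ^ L * (1 / 4) := by
          intro i
          have hs := hlow i
          -- Each pair of elements gains `1 / 64` and loses at most `γ⁻¹ ^ 2 = 4`, a net `2 ^ (-4)`;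
          -- the lower bound on `#(E i)` makes this at most `2 ^ (-(L + 2))`.
          calc (1 / 64 : ℝ) ^ (#(E i) / 2) * (1 / 2 : ℝ)⁻¹ ^ (#(E i) - 1)
              ≤ (1 / 64 : ℝ) ^ (#(E i) / 2) * (1 / 2 : ℝ)⁻¹ ^ (2 * (#(E i) / 2)) := by
                gcongr
                · norm_num
                · omega
            _ = (1 / 2) ^ (4 * (#(E i) / 2)) := by
                rw [pow_mul, pow_mul, ← mul_pow]; norm_num
            _ ≤ (1 / 2) ^ (L + 2) :=
                pow_le_pow_of_le_one (by norm_num) (by norm_num) (by omega)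
            _ = _ := by rw [pow_add]; norm_num
        calc _ ≤ ∑ i with v ∈ E i, (1 / 2 : ℝ) ^ L * (1 / 4) := sum_le_sum fun i _ => hterm i
          _ = #{i | v ∈ E i} * ((1 / 2 : ℝ) ^ L * (1 / 4)) := by simp
          _ ≤ (2 ^ L : ℕ) * ((1 / 2 : ℝ) ^ L * (1 / 4)) := by
              gcongr
              exact hE v
          _ = 1 / 4 := by
              push_cast
              rw [← mul_assoc, ← mul_pow]
              norm_num
      have h2 : ∑ p : P with v ∈ ({p.1.1, p.1.2} : Finset V),
          (q : ℝ)⁻¹ * (1 / 2 : ℝ)⁻¹ ^ (#({p.1.1, p.1.2} : Finset V) - 1) ≤ 1 / 4 := by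
        -- Conflicts are indexed by ordered pairs, hence `2 * d` of them at `v`.
        have hcard : #{p : P | v ∈ ({p.1.1, p.1.2} : Finset V)} ≤ 2 * d := by
          have hsub : (univ.filter fun p : P => v ∈ ({p.1.1, p.1.2} : Finset V)).image Subtype.val ⊆
              ((H v).image fun y => (v, y)) ∪ ((H v).image fun y => (y, v)) := by
            intro p hp
            obtain ⟨⟨⟨x, y⟩, hxy⟩, hv, rfl⟩ := mem_image.1 hp
            have hv' := (mem_filter.1 hv).2
            simp only [mem_insert, mem_singleton] at hv'
            rcases hv' with rfl | rfl
            · exact mem_union_left _ (mem_image_of_mem _ hxy)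
            · exact mem_union_right _ (mem_image.2 ⟨x, hsymm _ _ hxy, rfl⟩)
          rw [← card_image_of_injective _ Subtype.val_injective]
          have h3 := (card_le_card hsub).trans (card_union_le _ _)
          have h4 : #((H v).image fun y => (v, y)) ≤ #(H v) := card_image_le
          have h5 : #((H v).image fun y => (y, v)) ≤ #(H v) := card_image_le
          have := hd v
          omega
        calc _ ≤ ∑ p : P with v ∈ ({p.1.1, p.1.2} : Finset V), (q : ℝ)⁻¹ * 2 := by
              refine sum_le_sum fun p _ => ?_
              gcongr
              have : #({p.1.1, p.1.2} : Finset V) ≤ 2 := card_le_two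
              calc (1 / 2 : ℝ)⁻¹ ^ (#({p.1.1, p.1.2} : Finset V) - 1)
                  ≤ (1 / 2 : ℝ)⁻¹ ^ 1 := pow_le_pow_right₀ (by norm_num) (by omega)
                _ = 2 := by norm_num
          _ = #{p : P | v ∈ ({p.1.1, p.1.2} : Finset V)} * ((q : ℝ)⁻¹ * 2) := by simp
          _ ≤ (2 * d : ℕ) * ((q : ℝ)⁻¹ * 2) := by
              gcongr
          _ ≤ 1 / 4 := by
              have : (16 * d : ℝ) ≤ q := by exact_mod_cast hq
              push_cast
              rw [← div_eq_inv_mul, ← mul_div_assoc, div_le_iff₀ hq0']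
              linarith
      have h3 : (1 : ℝ) - 1 / 2 = 1 / 4 + 1 / 4 := by norm_num
      rw [h3]
      refine add_le_add (le_trans (le_of_eq (by congr!)) h1) (le_trans (le_of_eq (by congr!)) h2))
  refine ⟨f, fun x y hy => ?_, fun i => ?_⟩
  · exact hf (Sum.inr ⟨(x, y), hy⟩)
  · have := hf (Sum.inl i)
    simp only [Sum.elim_inl] at this
    push Not at this
    exact this

/-! ### Iterated splitting with separate palettes -/

open Finset in
/-- A coloring of `B ∩ A` and a coloring of `B \ A` can be combined by using separate palettes. -/
theorem combine_colorings {V ι : Type*} [DecidableEq V] (E : ι → Finset V) (H : V → Finset V)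
    (A B : Finset V) (I J K : Finset ι) (hI : ∀ i ∈ I, i ∈ J ∨ i ∈ K) (g f : V → ℕ) (q n : ℕ)
    (hgq : ∀ x ∈ B ∩ A, g x < q) (hfn : ∀ x ∈ B \ A, f x < n)
    (hgH : ∀ x ∈ B ∩ A, ∀ y ∈ B ∩ A, y ∈ H x → g x ≠ g y)
    (hfH : ∀ x ∈ B \ A, ∀ y ∈ B \ A, y ∈ H x → f x ≠ f y)
    (hg : ∀ i ∈ J, ∃ x ∈ E i ∩ (B ∩ A), ∀ y ∈ E i ∩ (B ∩ A), y ≠ x → g y ≠ g x)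
    (hf : ∀ i ∈ K, ∃ x ∈ E i ∩ (B \ A), ∀ y ∈ E i ∩ (B \ A), y ≠ x → f y ≠ f x) :
    ∃ c : V → ℕ, (∀ x ∈ B, c x < q + n) ∧ (∀ x ∈ B, ∀ y ∈ B, y ∈ H x → c x ≠ c y) ∧
      ∀ i ∈ I, ∃ x ∈ E i ∩ B, ∀ y ∈ E i ∩ B, y ≠ x → c y ≠ c x := by
  refine ⟨fun x => if x ∈ A then g x else q + f x, ?_, ?_, ?_⟩
  · intro x hx
    by_cases hA : x ∈ A
    · have := hgq x (mem_inter.2 ⟨hx, hA⟩)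
      simp only [hA, if_true]
      omega
    · have := hfn x (mem_sdiff.2 ⟨hx, hA⟩)
      simp only [hA, if_false]
      omega
  · intro x hx y hy hxy
    by_cases hxA : x ∈ A <;> by_cases hyA : y ∈ A <;> simp only [hxA, hyA, if_true, if_false]
    · exact hgH x (mem_inter.2 ⟨hx, hxA⟩) y (mem_inter.2 ⟨hy, hyA⟩) hxy
    · have := hgq x (mem_inter.2 ⟨hx, hxA⟩)
      omega
    · have := hgq y (mem_inter.2 ⟨hy, hyA⟩)
      omega
    · have := hfH x (mem_sdiff.2 ⟨hx, hxA⟩) y (mem_sdiff.2 ⟨hy, hyA⟩) hxy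
      omega
  · intro i hi
    rcases hI i hi with h | h
    · obtain ⟨x, hx, hu⟩ := hg i h
      simp only [mem_inter] at hx hu
      refine ⟨x, mem_inter.2 ⟨hx.1, hx.2.1⟩, fun y hy hyx => ?_⟩
      rw [mem_inter] at hy
      have h1 := hgq x (mem_inter.2 hx.2)
      by_cases hyA : y ∈ A <;> simp only [hx.2.2, hyA, if_true, if_false]
      · exact hu y ⟨hy.1, hy.2, hyA⟩ hyx
      · omega
    · obtain ⟨x, hx, hu⟩ := hf i h
      simp only [mem_inter, mem_sdiff] at hx hu
      refine ⟨x, mem_inter.2 ⟨hx.1, hx.2.1⟩, fun y hy hyx => ?_⟩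
      rw [mem_inter] at hy
      by_cases hyA : y ∈ A <;> simp only [hx.2.2, hyA, if_true, if_false]
      · have h1 := hgq y (mem_inter.2 ⟨hy.2, hyA⟩)
        omega
      · have := hu y ⟨hy.1, hy.2, hyA⟩ hyx
        omega

open Finset in
/-- `exists_proper_coloring_unique_color` for the subgraph and the traces of hyperedges on `B`. -/
theorem exists_coloring_on {V ι : Type*} [Fintype V] [DecidableEq V] [Fintype ι]
    (E : ι → Finset V) (H : V → Finset V) {L d : ℕ} (hL : 1 ≤ L)
    (hirr : ∀ x, x ∉ H x) (hsymm : ∀ x y, y ∈ H x → x ∈ H y)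
    (hE : ∀ v, #{i | v ∈ E i} ≤ 2 ^ L) (B : Finset V) (I : Finset ι)
    (hd : ∀ x, #(H x ∩ B) ≤ d) (hlow : ∀ i ∈ I, 28 * L < 8 * #(E i ∩ B))
    (hupp : ∀ i ∈ I, #(E i ∩ B) < 224 * L) :
    ∃ f : V → ℕ, (∀ x, f x < 16 * d + 21504 * L) ∧
      (∀ x ∈ B, ∀ y ∈ B, y ∈ H x → f x ≠ f y) ∧
      ∀ i ∈ I, ∃ x ∈ E i ∩ B, ∀ y ∈ E i ∩ B, y ≠ x → f y ≠ f x := by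
  classical
  -- Conflict neighborhoods are emptied outside `B` to keep the relation symmetric. The palette
  -- contains `21504 = 96 * 224`, from the upper bound on the traces.
  obtain ⟨f, hf, hu⟩ := exists_proper_coloring_unique_color (ι := I)
    (fun i => E i ∩ B) (fun x => if x ∈ B then H x ∩ B else ∅) (L := L) (d := d)
    (q := 16 * d + 21504 * L) hL
    (fun x hx => by
      split_ifs at hx
      · exact hirr x (mem_inter.1 hx).1
      · simp at hx)
    (fun x y hy => by
      split_ifs at hy with hx
      · rw [mem_inter] at hy
        rw [if_pos hy.2, mem_inter]
        exact ⟨hsymm x y hy.1, hx⟩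
      · simp at hy)
    (fun x => by
      split_ifs
      · exact hd x
      · simp)
    (fun v => by
      refine le_trans ?_ (hE v)
      rw [← card_image_of_injective _ Subtype.val_injective]
      refine card_le_card fun i hi => ?_
      obtain ⟨j, hj, rfl⟩ := mem_image.1 hi
      exact mem_filter.2 ⟨mem_univ _, (mem_inter.1 (mem_filter.1 hj).2).1⟩)
    (fun i => hlow i i.2) (fun i => by
      have := hupp i i.2
      omega) (by omega) (by omega)
  refine ⟨fun x => f x, fun x => (f x).2, fun x hx y hy hxy h => ?_, fun i hi => ?_⟩
  · exact hf x y (by rw [if_pos hx]; exact mem_inter.2 ⟨hxy, hy⟩) (Fin.ext h)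
  · obtain ⟨x, hx, h⟩ := hu ⟨i, hi⟩
    exact ⟨x, hx, fun y hy hyx he => h y hy hyx (Fin.ext he)⟩

-- Induction on the number `t` of splits that bring every trace below `224 * L`. One round uses `16
-- * d + 21504 * L` colors and replaces `d` by at most `7 * d / 8 + 28 * L`, so the `d`-terms form a
-- geometric series with sum `8 * 16 * d = 128 * d`.
open Finset in
theorem exists_coloring_of_large {V ι : Type*} [Fintype V] [DecidableEq V] [Fintype ι]
    (E : ι → Finset V) (H : V → Finset V) {L : ℕ} (hL : 1 ≤ L)
    (hirr : ∀ x, x ∉ H x) (hsymm : ∀ x y, y ∈ H x → x ∈ H y)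
    (hE : ∀ v, #{i | v ∈ E i} ≤ 2 ^ L) (hEH : ∀ v, #{i | v ∈ E i} + #(H v) ≤ 4 ^ L) :
    ∀ (t d : ℕ) (B : Finset V) (I : Finset ι), (∀ x, #(H x ∩ B) ≤ d) →
      (∀ i ∈ I, 28 * L ≤ #(E i ∩ B)) → (∀ i ∈ I, 7 ^ t * #(E i ∩ B) < 8 ^ t * (224 * L)) →
      ∃ f : V → ℕ, (∀ x ∈ B, f x < 128 * d + (t + 1) * (30000 * L)) ∧
        (∀ x ∈ B, ∀ y ∈ B, y ∈ H x → f x ≠ f y) ∧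
        ∀ i ∈ I, ∃ x ∈ E i ∩ B, ∀ y ∈ E i ∩ B, y ≠ x → f y ≠ f x := by
  intro t
  induction t with
  | zero =>
    intro d B I hd hlow hupp
    obtain ⟨f, hf, h1, h2⟩ := exists_coloring_on E H hL hirr hsymm hE B I hd
      (fun i hi => by have := hlow i hi; omega) (fun i hi => by simpa using hupp i hi)
    exact ⟨f, fun x _ => by have := hf x; omega, h1, h2⟩
  | succ t ih =>
    intro d B I hd hlow hupp
    classical
    -- The split balances the traces of hyperedges and of the large conflict neighborhoods at once;
    -- by symmetry `v` lies in at most `#(H v)` of the latter.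
    obtain ⟨A, hA⟩ := exists_balanced_split (V := V)
      (ι := I ⊕ {x : V // 28 * L ≤ #(H x ∩ B)})
      (Sum.elim (fun i => E i ∩ B) fun x => H x ∩ B) hL
      (fun v => by
        refine le_trans ?_ (hEH v)
        rw [card_filter, Fintype.sum_sum_type, ← card_filter, ← card_filter]
        refine add_le_add ?_ ?_
        · rw [← card_image_of_injective _ Subtype.val_injective]
          refine card_le_card fun i hi => ?_
          obtain ⟨j, hj, rfl⟩ := mem_image.1 hi
          exact mem_filter.2 ⟨mem_univ _, (mem_inter.1 (mem_filter.1 hj).2).1⟩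
        · rw [← card_image_of_injective _ Subtype.val_injective]
          refine card_le_card fun i hi => ?_
          obtain ⟨j, hj, rfl⟩ := mem_image.1 hi
          exact hsymm _ _ (mem_inter.1 (mem_filter.1 hj).2).1)
      (by
        rintro (i | x)
        · exact hlow i i.2
        · exact x.2)
    have hAE : ∀ i ∈ I, #(E i ∩ B) < 8 * #(E i ∩ (B ∩ A)) ∧
        #(E i ∩ B) < 8 * #(E i ∩ (B \ A)) := fun i hi => by
      have := hA (Sum.inl ⟨i, hi⟩)
      simpa only [Sum.elim_inl, inter_assoc, inter_sdiff_assoc] using this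
    have hAH : ∀ x, #(H x ∩ (B \ A)) ≤ 7 * d / 8 + 28 * L := fun x => by
      have hsplit := card_sdiff_add_card_inter (H x ∩ B) A
      have hdx := hd x
      rw [← inter_sdiff_assoc]
      by_cases hx : 28 * L ≤ #(H x ∩ B)
      · have := (hA (Sum.inr ⟨x, hx⟩)).1
        simp only [Sum.elim_inr] at this
        omega
      · omega
    obtain ⟨g, hgq, hgH, hgu⟩ := exists_coloring_on E H (d := d) hL hirr hsymm hE (B ∩ A)
      (I.filter fun i => #(E i ∩ B) < 224 * L)
      (fun x => (card_le_card (inter_subset_inter_left inter_subset_left)).trans (hd x))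
      (fun i hi => by
        rw [mem_filter] at hi
        have h1 := hAE i hi.1
        have h2 := hlow i hi.1
        omega)
      (fun i hi => by
        rw [mem_filter] at hi
        exact (card_le_card (inter_subset_inter_left inter_subset_left)).trans_lt hi.2)
    -- Traces of size at least `224 * L` keep more than an eighth, hence at least `28 * L` elements,
    -- and lose more than an eighth, which pays for one factor `8 / 7`.
    obtain ⟨f, hfn, hfH, hfu⟩ := ih (7 * d / 8 + 28 * L) (B \ A)
      (I.filter fun i => ¬ #(E i ∩ B) < 224 * L) hAH
      (fun i hi => by
        rw [mem_filter] at hi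
        have h1 := hAE i hi.1
        omega)
      (fun i hi => by
        rw [mem_filter] at hi
        have h1 := (hAE i hi.1).1
        have h2 := card_sdiff_add_card_inter (E i ∩ B) A
        rw [inter_sdiff_assoc, inter_assoc] at h2
        have h3 := hupp i hi.1
        have h4 : 8 * #(E i ∩ (B \ A)) ≤ 7 * #(E i ∩ B) := by omega
        have h5 := Nat.mul_le_mul_left (7 ^ t) h4
        rw [pow_succ, pow_succ] at h3
        nlinarith)
    obtain ⟨c, hc, hcH, hcu⟩ := combine_colorings E H A B I _ _
      (fun i hi => by
        simp only [mem_filter, hi, true_and]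
        exact em _) g f _ _ (fun x _ => hgq x) hfn hgH hfH hgu hfu
    refine ⟨c, fun x hx => (hc x hx).trans_le ?_, hcH, hcu⟩
    have : 8 * (7 * d / 8) ≤ 7 * d := Nat.mul_div_le _ _
    have e : (t + 1 + 1) * (30000 * L) = (t + 1) * (30000 * L) + 30000 * L := by ring
    omega

/-! ### Conflicts in star-free graphs -/

open Finset in
/-- A greedily chosen independent set in a set of vertices of small induced degree. -/
theorem SimpleGraph.exists_isIndepSet_card_le_mul {V : Type*} [Fintype V] [DecidableEq V]
    (G : SimpleGraph V) [DecidableRel G.Adj] (X : Finset V) (D : ℕ)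
    (hD : ∀ x ∈ X, G.degree x < D) :
    ∃ I ⊆ X, G.IsIndepSet (I : Set V) ∧ #X ≤ #I * D := by
  classical
  obtain ⟨I, hI, hmax⟩ := (X.powerset.filter fun I : Finset V => G.IsIndepSet (I : Set V)).exists_max_image
    card ⟨∅, by simp [SimpleGraph.IsIndepSet]⟩
  rw [mem_filter, mem_powerset] at hI
  refine ⟨I, hI.1, hI.2, ?_⟩
  -- Closed neighborhoods of a maximum independent subset of `X` cover `X`, and each has at most `D`
  -- elements.
  have hcover : X ⊆ I.biUnion fun y => insert y (G.neighborFinset y) := by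
    intro x hx
    by_contra hcon
    simp only [mem_biUnion, mem_insert, SimpleGraph.mem_neighborFinset, not_exists, not_and,
      not_or] at hcon
    have hxI : x ∉ I := fun h => (hcon x h).1 rfl
    have := hmax (insert x I) (by
      rw [mem_filter, mem_powerset]
      refine ⟨insert_subset hx hI.1, ?_⟩
      rw [coe_insert, SimpleGraph.IsIndepSet, Set.pairwise_insert]
      exact ⟨hI.2, fun y hy _ => ⟨fun h => (hcon y hy).2 h.symm, fun h => (hcon y hy).2 h⟩⟩)
    rw [card_insert_of_notMem hxI] at this
    omega
  refine (card_le_card hcover).trans (card_biUnion_le_card_mul _ _ _ fun y hy => ?_)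
  have h1 := card_insert_le y (G.neighborFinset y)
  have h2 := hD y (hI.1 hy)
  rw [SimpleGraph.card_neighborFinset_eq_degree] at h1
  omega

open Finset in
theorem SimpleGraph.StarFree.card_lt_of_isIndepSet {V : Type*} {G : SimpleGraph V} {k : ℕ}
    (hG : G.StarFree k) {x : V} {I : Finset V} (hx : ∀ y ∈ I, G.Adj x y)
    (hI : G.IsIndepSet (I : Set V)) : #I < k := by
  by_contra! hk
  obtain ⟨J, hJI, hJ⟩ := exists_subset_card_eq hk
  let g := J.equivFinOfCardEq hJ
  have hgI : ∀ j, (g.symm j : V) ∈ I := fun j => hJI (g.symm j).2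
  have hadj : ∀ j, G.Adj x (g.symm j) := fun j => hx _ (hgI j)
  refine hG ⟨⟨⟨Sum.elim (fun _ => x) fun j => (g.symm j : V), ?_⟩, ?_⟩⟩
  · rintro (a | a) (b | b) h
    · exact congrArg _ (Subsingleton.elim a b)
    · exact absurd h (hadj b).ne
    · exact absurd h (hadj a).ne'
    · exact congrArg _ (g.symm.injective (Subtype.ext h))
  · rintro (a | a) (b | b)
    · exact iff_of_false G.irrefl (by simp)
    · exact iff_of_true (hadj b) (by simp)
    · exact iff_of_true (hadj a).symm (by simp)
    · exact iff_of_false (fun h => hI (hgI a) (hgI b) h.ne h) (by simp)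

/-- The vertices that share a neighbor of degree less than `D` with `x`. -/
def SimpleGraph.lowDegreeConflicts {V : Type*} [Fintype V] [DecidableEq V] (G : SimpleGraph V)
    [DecidableRel G.Adj] (D : ℕ) (x : V) : Finset V :=
  {y | y ≠ x ∧ ∃ v, G.Adj v x ∧ G.Adj v y ∧ G.degree v < D}

-- The low-degree neighbors of `x` contain an independent set with at least a `1 / D` fraction of
-- them. Star-freeness bounds it by `k`, so there are at most `k * D` such neighbors, each with at
-- most `D` neighbors.
open Finset in
theorem SimpleGraph.card_lowDegreeConflicts_le {V : Type*} [Fintype V] [DecidableEq V]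
    (G : SimpleGraph V) [DecidableRel G.Adj] {k : ℕ} (hG : G.StarFree k) (D : ℕ) (x : V) :
    #(G.lowDegreeConflicts D x) ≤ k * D * D := by
  obtain ⟨I, hIX, hI, hcard⟩ := G.exists_isIndepSet_card_le_mul
    ((G.neighborFinset x).filter fun v => G.degree v < D) D fun v hv => (mem_filter.1 hv).2
  have hIk : #I < k := hG.card_lt_of_isIndepSet (x := x)
    (fun y hy => (G.mem_neighborFinset x y).1 (mem_filter.1 (hIX hy)).1) hI
  have hsub : G.lowDegreeConflicts D x ⊆
      ((G.neighborFinset x).filter fun v => G.degree v < D).biUnion fun v => G.neighborFinset v := by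
    intro y hy
    obtain ⟨-, v, hvx, hvy, hv⟩ := (mem_filter.1 hy).2
    exact mem_biUnion.2 ⟨v, mem_filter.2 ⟨(G.mem_neighborFinset _ _).2 hvx.symm, hv⟩,
      (G.mem_neighborFinset _ _).2 hvy⟩
  refine (card_le_card hsub).trans ((card_biUnion_le_card_mul _ _ D fun v hv => ?_).trans ?_)
  · rw [G.card_neighborFinset_eq_degree]
    exact (mem_filter.1 hv).2.le
  · exact Nat.mul_le_mul_right _ (hcard.trans (Nat.mul_le_mul_right _ hIk.le))

-- This bound, free of `k`, keeps the number of sets through a vertex below `4 ^ L` for the balanced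
-- split.
open Finset in
theorem SimpleGraph.card_lowDegreeConflicts_le_maxDegree {V : Type*} [Fintype V] [DecidableEq V]
    (G : SimpleGraph V) [DecidableRel G.Adj] (D : ℕ) (x : V) :
    #(G.lowDegreeConflicts D x) ≤ G.maxDegree * G.maxDegree := by
  have hsub : G.lowDegreeConflicts D x ⊆ (G.neighborFinset x).biUnion fun v => G.neighborFinset v := by
    intro y hy
    obtain ⟨-, v, hvx, hvy, hv⟩ := (mem_filter.1 hy).2
    exact mem_biUnion.2 ⟨v, (G.mem_neighborFinset _ _).2 hvx.symm,
      (G.mem_neighborFinset _ _).2 hvy⟩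
  refine (card_le_card hsub).trans ((card_biUnion_le_card_mul _ _ G.maxDegree fun v _ => ?_).trans
    (Nat.mul_le_mul_right _ ?_)) <;>
  · rw [G.card_neighborFinset_eq_degree]
    exact G.degree_le_maxDegree _

open Finset in
theorem SimpleGraph.StarFree.conflictFreeColorable {V : Type*} [Fintype V] {G : SimpleGraph V}
    [DecidableRel G.Adj] {k L : ℕ} (hG : G.StarFree k) (hiso : ∀ v, ∃ w, G.Adj v w)
    (hL : 1 ≤ L) (hΔ : G.maxDegree < 2 ^ L) :
    G.openNeighborhoodHypergraph.ConflictFreeColorable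
      (128 * (k * (28 * L) * (28 * L)) + (6 * L + 1) * (30000 * L)) := by
  classical
  have hdeg : ∀ v, #{i | v ∈ G.neighborFinset i} ≤ G.maxDegree := fun v => by
    refine le_trans (card_le_card fun i hi => ?_) (G.degree_le_maxDegree v)
    rw [mem_filter, G.mem_neighborFinset] at hi
    exact (G.mem_neighborFinset _ _).2 hi.2.symm
  obtain ⟨f, hf, hfH, hfu⟩ := exists_coloring_of_large (fun v => G.neighborFinset v)
    (G.lowDegreeConflicts (28 * L)) hL
    (fun x hx => (mem_filter.1 hx).2.1 rfl)
    (fun x y hy => by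
      obtain ⟨hne, v, hvx, hvy, hv⟩ := (mem_filter.1 hy).2
      exact mem_filter.2 ⟨mem_univ _, hne.symm, v, hvy, hvx, hv⟩)
    (fun v => (hdeg v).trans hΔ.le)
    (fun v => by
      have h1 := hdeg v
      have h2 := G.card_lowDegreeConflicts_le_maxDegree (28 * L) v
      have h3 : (4 : ℕ) ^ L = 2 ^ L * 2 ^ L := by rw [← mul_pow]; norm_num
      rw [h3]
      nlinarith)
    -- `6 * L` rounds suffice because `2 < (8 / 7) ^ 6` and all degrees are below `2 ^ L`.
    (6 * L) (k * (28 * L) * (28 * L)) univ {i | 28 * L ≤ G.degree i}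
    (fun x => by
      rw [inter_univ]
      exact G.card_lowDegreeConflicts_le hG _ x)
    (fun i hi => by
      rw [inter_univ]
      exact (mem_filter.1 hi).2)
    (fun i _ => by
      rw [inter_univ, G.card_neighborFinset_eq_degree]
      have h1 : G.degree i < 2 ^ L := (G.degree_le_maxDegree i).trans_lt hΔ
      calc 7 ^ (6 * L) * G.degree i < 7 ^ (6 * L) * 2 ^ L := by gcongr
        _ = (7 ^ 6 * 2) ^ L := by rw [pow_mul, mul_pow]
        _ ≤ (8 ^ 6) ^ L := by gcongr; norm_num
        _ = 8 ^ (6 * L) * 1 := by rw [pow_mul, mul_one]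
        _ ≤ 8 ^ (6 * L) * (224 * L) := by gcongr; omega)
  refine ⟨f, fun v _ => hf v (mem_univ v), ?_⟩
  rintro _ ⟨v, rfl⟩
  by_cases hv : 28 * L ≤ G.degree v
  · obtain ⟨x, hx, hu⟩ := hfu v (mem_filter.2 ⟨mem_univ _, hv⟩)
    simp only [inter_univ, G.mem_neighborFinset] at hx hu
    exact ⟨x, hx, fun y hy hyx => hu y hy hyx⟩
  -- Neighbors of a low-degree vertex conflict pairwise, so any neighbor has a unique color; one
  -- exists since `v` is not isolated.
  · obtain ⟨w, hw⟩ := hiso v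
    refine ⟨w, hw, fun y hy hyw => hfH y (mem_univ _) w (mem_univ _) ?_⟩
    exact mem_filter.2 ⟨mem_univ _, hyw.symm, v, hy, hw, by omega⟩

/-! ### The bound in terms of `log Δ` -/

theorem Hypergraph.ConflictFreeColorable.exists_conflictFreeChromaticNumber_eq {V : Type*}
    {H : Hypergraph V} {m : ℕ} (h : H.ConflictFreeColorable m) :
    ∃ n : ℕ, H.conflictFreeChromaticNumber = n ∧ n ≤ m := by
  have hle : H.conflictFreeChromaticNumber ≤ m := iInf₂_le m h
  obtain ⟨n, hn⟩ := ENat.ne_top_iff_exists.1 (ne_top_of_le_ne_top (ENat.natCast_ne_top m) hle)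
  refine ⟨n, hn.symm, ?_⟩
  rw [← hn] at hle
  exact_mod_cast hle

theorem theorem1 (ε : ℝ) (hε : 0 < ε) :
    ∃ C : ℝ, ∀ (V : Type*) [Fintype V] (G : SimpleGraph V) [DecidableRel G.Adj] (k : ℕ),
      G.StarFree k → (∀ v, ∃ w, G.Adj v w) → 2 ≤ G.maxDegree →
        ∃ n : ℕ, G.cfonChromaticNumber = (n : ℕ∞) ∧
          (n : ℝ) ≤ C * ((k : ℝ) * Real.log (G.maxDegree : ℝ) ^ (2 + ε)) := by
  have hlog2 : 0 < Real.log 2 := Real.log_pos one_lt_two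
  -- The factor `(2 / log 2) ^ 2` converts `L` to `log Δ`; dividing by `(log 2) ^ ε` uses `log Δ ≥
  -- log 2` to introduce the superfluous power `ε`.
  refine ⟨400000 * (2 / Real.log 2) ^ 2 / Real.log 2 ^ ε, fun V _ G _ k hG hiso hΔ => ?_⟩
  set l := Real.log (G.maxDegree : ℝ) with hl
  set L := Nat.log 2 G.maxDegree + 1 with hLdef
  obtain ⟨n, hn, hle⟩ := (hG.conflictFreeColorable hiso (L := L) (by omega)
    (Nat.lt_pow_succ_log_self one_lt_two _)).exists_conflictFreeChromaticNumber_eq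
  refine ⟨n, hn, ?_⟩
  -- `S_0` is a single vertex, so a nonempty graph is not `S_0`-free. This lets the term of order `L
  -- ^ 2` without `k` be absorbed.
  have hk : 1 ≤ k := by
    by_contra! hk
    have h0 : 0 < G.maxDegree := by omega
    have : Nonempty V := by
      by_contra hV
      rw [not_nonempty_iff] at hV
      simp at h0
    obtain ⟨v⟩ := this
    have := hG.card_lt_of_isIndepSet (x := v) (I := ∅) (by simp) (by simp [SimpleGraph.IsIndepSet])
    omega
  have hll : Real.log 2 ≤ l := Real.log_le_log two_pos (by exact_mod_cast hΔ)
  have hl0 : 0 < l := hlog2.trans_le hll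
  have hL : (L : ℝ) ≤ 2 / Real.log 2 * l := by
    have h1 : (2 : ℝ) ^ Nat.log 2 G.maxDegree ≤ G.maxDegree := by
      exact_mod_cast Nat.pow_log_le_self 2 (by omega)
    have h2 := Real.log_le_log (by positivity) h1
    rw [Real.log_pow] at h2
    rw [div_mul_eq_mul_div, le_div_iff₀ hlog2, hLdef]
    push_cast
    linarith
  have hn1 : n ≤ 400000 * (k * L ^ 2) := by
    have h1 : L ^ 2 ≤ k * L ^ 2 := Nat.le_mul_of_pos_left _ hk
    have h2 : L ≤ L ^ 2 := Nat.le_self_pow two_ne_zero L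
    nlinarith
  have hε1 : Real.log 2 ^ ε ≤ l ^ ε := Real.rpow_le_rpow hlog2.le hll hε.le
  have hε0 : 0 < Real.log 2 ^ ε := Real.rpow_pos_of_pos hlog2 ε
  rw [Real.rpow_add hl0, Real.rpow_two]
  calc (n : ℝ) ≤ 400000 * (k * (L : ℝ) ^ 2) := by exact_mod_cast hn1
    _ ≤ 400000 * (k * (2 / Real.log 2 * l) ^ 2) := by gcongr
    _ = 400000 * (2 / Real.log 2) ^ 2 / Real.log 2 ^ ε * (k * (l ^ 2 * Real.log 2 ^ ε)) := by
        field_simp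
    _ ≤ _ := by gcongr
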